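/- An involution on a ring $R$ is an additive map $\ast\colon R\to R$ with $(ab)^\ast=b^\ast a^\ast$ and $a^{\ast\ast}=a$. It is called formally real if every nonempty finite sum of nonzero elements of the form $rr^\ast$ ($r\in R$) is nonzero. A unital hermitian cone on $(R,\ast)$ is a subset $M\subseteq\{a\in R: a^\ast=a\}$ with $1\in M$, $M+M\subseteq M$, $aMa^\ast\subseteq M$ for every $a\in R$, and $M\cap -M=\{0\}$. Let $K/F$ be a finite Galois extension of fields with Galois group $G$, acting on $K$ from the right by $k\mapsto k^\sigma$, so that $(k^\sigma)^\tau=k^{\sigma\tau}$. Let $\Phi\colon G\times G\to K\setminus\{0\}$ be a normalized $2$-cocycle, i.e. $\Phi(\sigma\tau,\rho)\,\Phi(\sigma,\tau)^\rho=\Phi(\sigma,\tau\rho)\,\Phi(\tau,\rho)$ and $\Phi(\mathrm{id},\sigma)=\Phi(\sigma,\mathrm{id})=1$ for all $\sigma,\tau,\rho\in G$. Let $D=(K/F,\Phi)$ be the crossed product algebra, i.e. the right $K$-vector space with basis $(e_\sigma)_{\sigma\in G}$ and multiplication $$\Bigl(\sum_{\sigma} e_\sigma c_\sigma\Bigr)\Bigl(\sum_{\tau}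 e_\tau d_\tau\Bigr)=\sum_{\sigma,\tau} e_{\sigma\tau}\,\Phi(\sigma,\tau)\,c_\sigma^{\tau}\,d_\tau ,$$ in which $K$ is embedded by $k\mapsto e_{\mathrm{id}}k$. **Theorem.** Suppose that $D$ is a division algebra and that $\ast$ is an involution on $D$ with $K^\ast\subseteq K$ (hence also $F^\ast\subseteq F$, since $F$ is the center of $D$). Equip $D\otimes_F K$ with the involution extending that of $D$, $(d\otimes k)^\ast=d^\ast\otimes k^\ast$. Then the following assertions are equivalent: 1. the involution on $D\otimes_F K$ is formally real; 2. the involution on $D$ is formally real, and $(k^\ast)^\sigma=(k^\sigma)^\ast$ for all $k\in K$ and $\sigma\in G$; 3. $e_\sigma^\ast e_\sigma\in K$ for every $\sigma\in G$, and there is a unital hermitian cone on $(K,\ast|_K)$ which contains all the elements $e_\sigma^\ast e_\sigma$, $\sigma\in G$. -/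

import Mathlib

open scoped TensorProduct

/-! Involutions, formal reality and hermitian cones -/

/-- The involution `inv` on the ring `R` is formally real: every (nonempty) finite sum of nonzero
elements of the form `r * r^*` is nonzero. -/
def IsFormallyRealInvolution {R : Type*} [Ring R] (inv : R → R) : Prop :=
  ∀ (n : ℕ) (r : Fin (n + 1) → R), (∀ i, r i * inv (r i) ≠ 0) → ∑ i, r i * inv (r i) ≠ 0

/-- A unital hermitian cone on the ring `R` with involution `inv`: a set `M` of hermitian elements
with `M + M ⊆ M`, `a M a^* ⊆ M` for all `a ∈ R`, `M ∩ -M = {0}` and `1 ∈ M`. -/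
structure IsUnitalHermitianCone {R : Type*} [Ring R] (inv : R → R) (M : Set R) : Prop where
  hermitian : ∀ a ∈ M, inv a = a
  add_mem : ∀ a ∈ M, ∀ b ∈ M, a + b ∈ M
  conj_mem : ∀ (a : R), ∀ b ∈ M, a * b * inv a ∈ M
  inter_neg : M ∩ {a | -a ∈ M} = {0}
  one_mem : (1 : R) ∈ M

/-! Crossed products.  The Galois group acts on `K` from the right, `k ^ σ = σ k`; accordingly the
product `στ` in the exponents is "first `σ`, then `τ`", i.e. `σ.trans τ`. -/

/-- A normalized (multiplicative) 2-cocycle `Φ : G × G → K \ {0}` on the Galois group `G` of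
`K / F`. -/
structure NormalizedCocycle (F K : Type*) [Field F] [Field K] [Algebra F K] where
  toFun : (K ≃ₐ[F] K) → (K ≃ₐ[F] K) → K
  ne_zero : ∀ σ τ, toFun σ τ ≠ 0
  cocycle : ∀ σ τ ρ,
    toFun (σ.trans τ) ρ * ρ (toFun σ τ) = toFun σ (τ.trans ρ) * toFun τ ρ
  one_left : ∀ σ, toFun AlgEquiv.refl σ = 1
  one_right : ∀ σ, toFun σ AlgEquiv.refl = 1

/-- The crossed product `(K / F, Φ)`: the right `K`-vector space with basis `(e_σ)_{σ ∈ G}`; the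
element `∑ e_σ c_σ` is the finitely supported function `σ ↦ c_σ`. -/
def CrossedProduct {F K : Type*} [Field F] [Field K] [Algebra F K]
    (_Φ : NormalizedCocycle F K) : Type _ :=
  (K ≃ₐ[F] K) →₀ K

namespace CrossedProduct

section Construction

variable {F K : Type*} [Field F] [Field K] [Algebra F K] {Φ : NormalizedCocycle F K}

noncomputable instance : AddCommGroup (CrossedProduct Φ) :=
  inferInstanceAs (AddCommGroup ((K ≃ₐ[F] K) →₀ K))

/-- The element `e_σ c`. -/
noncomputable def monomial (Φ : NormalizedCocycle F K) (σ : K ≃ₐ[F] K) (c : K) :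
    CrossedProduct Φ :=
  (Finsupp.single σ c : (K ≃ₐ[F] K) →₀ K)

/-- The basis element `e_σ`. -/
noncomputable def e (Φ : NormalizedCocycle F K) (σ : K ≃ₐ[F] K) : CrossedProduct Φ :=
  monomial Φ σ 1

/-- `(∑ e_σ c_σ) (∑ e_τ d_τ) = ∑ e_{στ} Φ(σ, τ) c_σ^τ d_τ`. -/
noncomputable instance : Mul (CrossedProduct Φ) where
  mul x y := Finsupp.sum x fun σ c => Finsupp.sum y fun τ d =>
    monomial Φ (σ.trans τ) (Φ.toFun σ τ * τ c * d)

noncomputable instance : One (CrossedProduct Φ) where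
  one := e Φ AlgEquiv.refl

theorem one_def : (1 : CrossedProduct Φ) = monomial Φ AlgEquiv.refl 1 := rfl

theorem mul_def (x y : CrossedProduct Φ) :
    x * y = Finsupp.sum x fun σ c => Finsupp.sum y fun τ d =>
      monomial Φ (σ.trans τ) (Φ.toFun σ τ * τ c * d) := rfl

theorem monomial_zero (σ : K ≃ₐ[F] K) : monomial Φ σ 0 = 0 :=
  Finsupp.single_zero σ

theorem monomial_add (σ : K ≃ₐ[F] K) (c d : K) :
    monomial Φ σ (c + d) = monomial Φ σ c + monomial Φ σ d :=
  Finsupp.single_add σ c d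

theorem monomial_injective (σ : K ≃ₐ[F] K) : Function.Injective (monomial Φ σ) :=
  Finsupp.single_injective σ

theorem induction {p : CrossedProduct Φ → Prop} (x : CrossedProduct Φ) (h0 : p 0)
    (hadd : ∀ x y, p x → p y → p (x + y)) (hm : ∀ σ c, p (monomial Φ σ c)) : p x :=
  Finsupp.induction_linear (motive := p) x h0 hadd hm

protected theorem zero_mul' (x : CrossedProduct Φ) : 0 * x = 0 :=
  Finsupp.sum_zero_index

protected theorem mul_zero' (x : CrossedProduct Φ) : x * 0 = 0 := by
  rw [mul_def]
  exact Finset.sum_eq_zero fun σ _ => Finsupp.sum_zero_index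

protected theorem add_mul' (x y z : CrossedProduct Φ) : (x + y) * z = x * z + y * z := by
  refine Finsupp.sum_add_index' (fun σ => ?_) (fun σ c d => ?_)
  · simp only [map_zero, mul_zero, zero_mul, monomial_zero]
    exact Finset.sum_const_zero
  · simp only [map_add, mul_add, add_mul, monomial_add]
    exact Finsupp.sum_add

protected theorem mul_add' (x y z : CrossedProduct Φ) : x * (y + z) = x * y + x * z := by
  simp only [mul_def]
  refine (Finsupp.sum_congr fun σ _ => Finsupp.sum_add_index' (fun τ => ?_)
    (fun τ c d => ?_)).trans Finsupp.sum_add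
  · simp only [mul_zero, monomial_zero]
  · simp only [mul_add, monomial_add]

theorem monomial_mul_monomial (σ τ : K ≃ₐ[F] K) (c d : K) :
    monomial Φ σ c * monomial Φ τ d = monomial Φ (σ.trans τ) (Φ.toFun σ τ * τ c * d) := by
  rw [mul_def]
  refine (Finsupp.sum_single_index ?_).trans (Finsupp.sum_single_index ?_)
  · simp only [map_zero, mul_zero, zero_mul, monomial_zero]
    exact Finset.sum_const_zero
  · simp only [mul_zero, monomial_zero]

protected theorem mul_assoc' (x y z : CrossedProduct Φ) : x * y * z = x * (y * z) := by
  induction x using CrossedProduct.induction with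
  | h0 => simp only [CrossedProduct.zero_mul']
  | hadd x x' hx hx' => simp only [CrossedProduct.add_mul', hx, hx']
  | hm σ a =>
    induction y using CrossedProduct.induction with
    | h0 => simp only [CrossedProduct.zero_mul', CrossedProduct.mul_zero']
    | hadd y y' hy hy' => simp only [CrossedProduct.add_mul', CrossedProduct.mul_add', hy, hy']
    | hm τ b =>
      induction z using CrossedProduct.induction with
      | h0 => simp only [CrossedProduct.mul_zero']
      | hadd z z' hz hz' => simp only [CrossedProduct.mul_add', hz, hz']
      | hm ρ c =>
        simp only [monomial_mul_monomial, map_mul]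
        have h := Φ.cocycle σ τ ρ
        congr 1
        simp only [AlgEquiv.trans_apply]
        linear_combination (ρ (τ a) * ρ b * c) * h

protected theorem one_mul' (x : CrossedProduct Φ) : 1 * x = x := by
  induction x using CrossedProduct.induction with
  | h0 => simp only [CrossedProduct.mul_zero']
  | hadd x y hx hy => simp only [CrossedProduct.mul_add', hx, hy]
  | hm σ c => simp [one_def, monomial_mul_monomial, Φ.one_left]; rfl

protected theorem mul_one' (x : CrossedProduct Φ) : x * 1 = x := by
  induction x using CrossedProduct.induction with
  | h0 => simp only [CrossedProduct.zero_mul']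
  | hadd x y hx hy => simp only [CrossedProduct.add_mul', hx, hy]
  | hm σ c => simp [one_def, monomial_mul_monomial, Φ.one_right]; rfl

noncomputable instance : Ring (CrossedProduct Φ) :=
  { (inferInstance : AddCommGroup (CrossedProduct Φ)) with
    mul := (· * ·)
    one := 1
    zero_mul := CrossedProduct.zero_mul'
    mul_zero := CrossedProduct.mul_zero'
    left_distrib := CrossedProduct.mul_add'
    right_distrib := CrossedProduct.add_mul'
    mul_assoc := CrossedProduct.mul_assoc'
    one_mul := CrossedProduct.one_mul'
    mul_one := CrossedProduct.mul_one' }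

/-- The embedding `k ↦ e_id k` of `K` into the crossed product, as a ring homomorphism. -/
noncomputable def inclRingHom (Φ : NormalizedCocycle F K) : K →+* CrossedProduct Φ where
  toFun k := monomial Φ AlgEquiv.refl k
  map_one' := rfl
  map_zero' := monomial_zero _
  map_add' := monomial_add _
  map_mul' a b := by
    rw [monomial_mul_monomial, Φ.one_left, one_mul]; rfl

/-- The crossed product is an `F`-algebra through `F ⊆ K`. -/
noncomputable instance : Algebra F (CrossedProduct Φ) :=
  RingHom.toAlgebra' ((inclRingHom Φ).comp (algebraMap F K)) fun a x => by
    induction x using CrossedProduct.induction with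
    | h0 => rw [mul_zero, zero_mul]
    | hadd x y hx hy => rw [mul_add, add_mul, hx, hy]
    | hm σ c =>
      change monomial Φ _ _ * monomial Φ _ _ = monomial Φ _ _ * monomial Φ _ _
      rw [monomial_mul_monomial, monomial_mul_monomial, Φ.one_left, Φ.one_right]
      simp only [AlgEquiv.commutes, one_mul, AlgEquiv.coe_refl, id_eq]
      rw [mul_comm]; rfl

/-- The embedding `k ↦ e_id k` of `K` into the crossed product. -/
noncomputable def incl (Φ : NormalizedCocycle F K) : K →ₐ[F] CrossedProduct Φ :=
  { inclRingHom Φ with commutes' := fun _ => rfl }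

theorem incl_injective : Function.Injective (incl Φ) :=
  monomial_injective AlgEquiv.refl

theorem incl_mul_e (k : K) (σ : K ≃ₐ[F] K) : incl Φ k * e Φ σ = e Φ σ * incl Φ (σ k) := by
  change monomial Φ _ _ * monomial Φ _ _ = monomial Φ _ _ * monomial Φ _ _
  rw [monomial_mul_monomial, monomial_mul_monomial, Φ.one_left, Φ.one_right]
  simp only [one_mul, mul_one, map_one]; rfl

theorem e_mul_incl (k : K) (σ : K ≃ₐ[F] K) : e Φ σ * incl Φ k = monomial Φ σ k := by
  change monomial Φ _ _ * monomial Φ _ _ = _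
  rw [monomial_mul_monomial, Φ.one_right]
  simp only [one_mul, map_one]; rfl

end Construction

section Involution

variable {F K : Type*} [Field F] [Field K] [Algebra F K] {Φ : NormalizedCocycle F K}
  [StarRing (CrossedProduct Φ)]

/-- The condition `K^* ⊆ K`. -/
def StarInvariant (Φ : NormalizedCocycle F K) [StarRing (CrossedProduct Φ)] : Prop :=
  ∀ k : K, star (incl Φ k) ∈ Set.range (incl Φ)

/-- The restriction of the involution to `K`. -/
noncomputable def starK (h : StarInvariant Φ) (k : K) : K := (h k).choose

theorem incl_starK (h : StarInvariant Φ) (k : K) : incl Φ (starK h k) = star (incl Φ k) :=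
  (h k).choose_spec

/-- `K` as a ring with the restricted involution. -/
noncomputable abbrev starRingK (h : StarInvariant Φ) : StarRing K where
  star := starK h
  star_involutive k := incl_injective (Φ := Φ) (by simp only [incl_starK, star_star])
  star_mul a b := incl_injective (Φ := Φ) (by
    simp only [incl_starK, map_mul, star_mul])
  star_add a b := incl_injective (Φ := Φ) (by simp only [incl_starK, map_add, star_add])

/-- The involution leaves `F`, the center of the crossed product, invariant. -/
theorem exists_starF [FiniteDimensional F K] [IsGalois F K] (h : StarInvariant Φ) (a : F) :
    ∃ b : F, algebraMap F K b = starK h (algebraMap F K a) := by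
  have hc : ∀ x : CrossedProduct Φ, incl Φ (starK h (algebraMap F K a)) * x
      = x * incl Φ (starK h (algebraMap F K a)) := fun x => by
    rw [incl_starK, AlgHom.commutes]
    conv_lhs => rw [← star_star x, ← star_mul, ← Algebra.commutes, star_mul, star_star]
  have hfix : ∀ σ : K ≃ₐ[F] K,
      σ (starK h (algebraMap F K a)) = starK h (algebraMap F K a) := fun σ => by
    have h1 := hc (e Φ σ)
    rw [incl_mul_e, e_mul_incl, e_mul_incl] at h1
    exact monomial_injective σ h1
  exact (IsGalois.mem_range_algebraMap_iff_fixed _).2 hfix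

/-- The restriction of the involution to `F`. -/
noncomputable def starF [FiniteDimensional F K] [IsGalois F K] (h : StarInvariant Φ) (a : F) : F :=
  (exists_starF h a).choose

theorem algebraMap_starF [FiniteDimensional F K] [IsGalois F K] (h : StarInvariant Φ) (a : F) :
    algebraMap F K (starF h a) = starK h (algebraMap F K a) :=
  (exists_starF h a).choose_spec

/-- `F` as a ring with the restricted involution. -/
noncomputable abbrev starRingF [FiniteDimensional F K] [IsGalois F K] (h : StarInvariant Φ) :
    StarRing F :=
  letI := starRingK h
  { star := starF h
    star_involutive := fun a => (algebraMap F K).injective (by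
      simp only [algebraMap_starF]; exact star_star (algebraMap F K a))
    star_mul := fun a b => (algebraMap F K).injective (by
      simp only [algebraMap_starF, map_mul]
      exact star_mul (algebraMap F K a) (algebraMap F K b))
    star_add := fun a b => (algebraMap F K).injective (by
      simp only [algebraMap_starF, map_add]
      exact star_add (algebraMap F K a) (algebraMap F K b)) }

theorem starModuleK [FiniteDimensional F K] [IsGalois F K] (h : StarInvariant Φ) :
    letI := starRingF h
    letI := starRingK h
    StarModule F K := by
  let _ := starRingF h
  let _ := starRingK h
  refine ⟨fun a k => ?_⟩
  rw [Algebra.smul_def, Algebra.smul_def, star_mul, mul_comm]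
  exact congrArg (· * star k) (algebraMap_starF h a).symm

theorem starModuleD [FiniteDimensional F K] [IsGalois F K] (h : StarInvariant Φ) :
    letI := starRingF h
    StarModule F (CrossedProduct Φ) := by
  let _ := starRingF h
  refine ⟨fun a x => ?_⟩
  rw [Algebra.smul_def, Algebra.smul_def, star_mul, Algebra.commutes]
  congr 1
  rw [← AlgHom.commutes (incl Φ), ← AlgHom.commutes (incl Φ), ← incl_starK h]
  exact congrArg (incl Φ) (algebraMap_starF h a).symm

/-- `(K / F, Φ) ⊗_F K` as a ring with the extended involution
`d ⊗ k ↦ d^* ⊗ k^*`. -/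
noncomputable abbrev starRingTensor [FiniteDimensional F K] [IsGalois F K]
    (h : StarInvariant Φ) : StarRing (CrossedProduct Φ ⊗[F] K) :=
  letI := starRingF h
  letI := starRingK h
  haveI := starModuleK h
  haveI := starModuleD h
  inferInstance

/-- The extension of the involution to `(K / F, Φ) ⊗_F K`. -/
noncomputable def starTensor [FiniteDimensional F K] [IsGalois F K] (h : StarInvariant Φ) :
    CrossedProduct Φ ⊗[F] K → CrossedProduct Φ ⊗[F] K :=
  (starRingTensor h).star

theorem starTensor_tmul [FiniteDimensional F K] [IsGalois F K] (h : StarInvariant Φ)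
    (d : CrossedProduct Φ) (k : K) :
    starTensor h (d ⊗ₜ[F] k) = star d ⊗ₜ[F] starK h k := rfl

end Involution

end CrossedProduct

/-! Write `D` for the crossed product.

From 3 to 1: `D ⊗ K` acts on `D` by `x ↦ d x k`, and faithfully, because `K ⊗ K ≅ ∏_σ K`
(`action_injective`). For the form `⟨x, y⟩`, the coefficient of `x^* y` at `e_id`, the involution of
`D ⊗ K` is the adjoint (`form_action`), and `⟨x, x⟩ = ∑ c_σ^* (e_σ^* e_σ) c_σ` (`form_self`), so the
form is positive definite with respect to the given cone. As for operators on a Hilbert space, `∑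
t_i t_i^* = 0` then forces every `t_i^*` to act as zero.

From 1 to 2: `D` embeds in `D ⊗ K`, and so does `K ⊗ K`. Formal reality forces the primitive
idempotents of `K ⊗ K`, which are indexed by `G`, to be hermitian; this says that `*` commutes with
each `σ`.

From 2 to 3: `e_σ^* e_σ` centralizes `K`, hence lies in `K`, and the sums of elements `d d^*` that
lie in `K` form the cone. -/

theorem IsFormallyRealInvolution.list_sum_ne_zero {R : Type*} [Ring R] {inv : R → R}
    (h : IsFormallyRealInvolution inv) (l : List R) (hl : l ≠ [])
    (hmem : ∀ x ∈ l, x ∈ Set.range (fun r => r * inv r) \ {0}) : l.sum ≠ 0 := by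
  obtain ⟨a, l, rfl⟩ := List.exists_cons_of_ne_nil hl
  choose! g hg using fun x (hx : x ∈ a :: l) => (hmem x hx).1
  have key := h l.length (fun i => g ((a :: l).get i))
  have hi : ∀ i : Fin (l.length + 1),
      g ((a :: l).get i) * inv (g ((a :: l).get i)) = (a :: l).get i :=
    fun i => hg _ (List.get_mem _ _)
  simp only [hi] at key
  have hs : ∑ i : Fin (l.length + 1), (a :: l).get i = (a :: l).sum := by
    conv_rhs => rw [← List.ofFn_get (a :: l)]
    rw [List.sum_ofFn]
    rfl
  rw [hs] at key
  exact key fun i => (hmem _ (List.get_mem _ _)).2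

/-- In a formally real ring the sums of elements `r * r^*` form a pointed additive monoid. -/
theorem IsFormallyRealInvolution.eq_zero_of_add_eq_zero {R : Type*} [Ring R] {inv : R → R}
    (h : IsFormallyRealInvolution inv) {x y : R}
    (hx : x ∈ AddSubmonoid.closure (Set.range fun r => r * inv r))
    (hy : y ∈ AddSubmonoid.closure (Set.range fun r => r * inv r)) (hxy : x + y = 0) :
    x = 0 := by
  -- Formal reality concerns nonzero terms only, so zero is discarded from the generators.
  rw [← AddSubmonoid.closure_sdiff_singleton_zero] at hx hy
  obtain ⟨l, hl, rfl⟩ := AddSubmonoid.exists_list_of_mem_closure hx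
  obtain ⟨m, hm, rfl⟩ := AddSubmonoid.exists_list_of_mem_closure hy
  by_contra hne
  have hl0 : l ≠ [] := by rintro rfl; exact hne rfl
  refine h.list_sum_ne_zero (l ++ m) (by simp [hl0]) (fun z hz => ?_) (by rwa [List.sum_append])
  exact (List.mem_append.1 hz).elim (hl z) (hm z)

/-! ### The splitting `K ⊗ K ≅ ∏_σ K`. -/

section Galois

variable {F K : Type*} [Field F] [Field K] [Algebra F K]

/-- The homomorphism `K ⊗ K → ∏_σ K`, `k ⊗ l ↦ (σ k * l)_σ`. -/
noncomputable def galoisTensorHom (F K : Type*) [Field F] [Field K] [Algebra F K] :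
    K ⊗[F] K →ₐ[F] ((K ≃ₐ[F] K) → K) :=
  AlgHom.pi fun σ => Algebra.TensorProduct.productMap (σ : K →ₐ[F] K) (AlgHom.id F K)

@[simp] theorem galoisTensorHom_tmul (k l : K) (σ : K ≃ₐ[F] K) :
    galoisTensorHom F K (k ⊗ₜ l) σ = σ k * l := by
  simp [galoisTensorHom]

/-- A `K`-linear functional vanishing on all vectors `(σ k)_σ` is a linear relation between
automorphisms, hence zero by Dedekind independence. The image is a `K`-subspace through the second
tensor factor. -/
theorem galoisTensorHom_surjective [FiniteDimensional F K] :
    Function.Surjective (galoisTensorHom F K) := by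
  have hspan : Submodule.span K (Set.range fun (k : K) (σ : K ≃ₐ[F] K) => σ k) = ⊤ := by
    by_contra hne
    obtain ⟨f, hf0, hf⟩ := Submodule.exists_le_ker_of_lt_top _ (lt_top_iff_ne_top.2 hne)
    apply hf0
    have hli := (linearIndependent_toLinearMap F K K).comp
      (fun σ : K ≃ₐ[F] K => (σ : K →ₐ[F] K)) (fun σ τ h => AlgEquiv.ext fun k =>
        DFunLike.congr_fun h k)
    classical
    have hcoef := Fintype.linearIndependent_iff.1 hli (fun σ => f (Pi.single σ 1)) (by
      ext k
      have hk : f (fun σ => σ k) = 0 := hf (Submodule.subset_span ⟨k, rfl⟩)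
      rw [LinearMap.pi_apply_eq_sum_univ f] at hk
      simp only [LinearMap.sum_apply, LinearMap.smul_apply, LinearMap.zero_apply]
      rw [← hk]
      refine Finset.sum_congr rfl fun σ _ => ?_
      rw [smul_eq_mul, smul_eq_mul, mul_comm]
      refine congrArg (σ k * f ·) (funext fun τ => ?_)
      simp [Pi.single_apply, eq_comm])
    refine LinearMap.pi_ext' fun σ => LinearMap.ext_ring ?_
    simpa using hcoef σ
  intro v
  have hv : v ∈ Submodule.span K (Set.range fun (k : K) (σ : K ≃ₐ[F] K) => σ k) := by
    rw [hspan]; trivial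
  induction hv using Submodule.span_induction with
  | mem x hx =>
    obtain ⟨k, rfl⟩ := hx
    exact ⟨k ⊗ₜ 1, by ext σ; simp⟩
  | zero => exact ⟨0, map_zero _⟩
  | add x y _ _ hx hy =>
    obtain ⟨a, rfl⟩ := hx
    obtain ⟨b, rfl⟩ := hy
    exact ⟨a + b, map_add _ _ _⟩
  | smul c x _ hx =>
    obtain ⟨a, rfl⟩ := hx
    exact ⟨a * 1 ⊗ₜ c, by ext σ; simp [mul_comm]⟩

/-- Both sides have `F`-dimension `[K : F]^2`, since `|G| = [K : F]`. -/
theorem galoisTensorHom_injective [FiniteDimensional F K] [IsGalois F K] :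
    Function.Injective (galoisTensorHom F K) := by
  have hfin : Module.finrank F (K ⊗[F] K) = Module.finrank F ((K ≃ₐ[F] K) → K) := by
    rw [Module.finrank_tensorProduct, Module.finrank_pi_fintype, Finset.sum_const,
      Finset.card_univ, ← Nat.card_eq_fintype_card, IsGalois.card_aut_eq_finrank, smul_eq_mul]
  exact (LinearMap.injective_iff_surjective_of_finrank_eq_finrank
    (f := (galoisTensorHom F K).toLinearMap) hfin).2 galoisTensorHom_surjective

end Galois

/-! ### Coefficients with respect to the basis `e_σ`. -/

namespace CrossedProduct

section Coefficients

variable {F K : Type*} [Field F] [Field K] [Algebra F K] {Φ : NormalizedCocycle F K}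

theorem smul_monomial (a : F) (σ : K ≃ₐ[F] K) (c : K) :
    a • monomial Φ σ c = monomial Φ σ (a • c) := by
  rw [Algebra.smul_def]
  change monomial Φ _ _ * _ = _
  rw [monomial_mul_monomial, Φ.one_left, Algebra.smul_def]
  simp only [one_mul, AlgEquiv.commutes]; rfl

open Classical in
/-- The coefficient of `e_σ`. -/
noncomputable def coeff (Φ : NormalizedCocycle F K) (σ : K ≃ₐ[F] K) : CrossedProduct Φ →ₗ[F] K :=
  let f : CrossedProduct Φ →+ K :=
    { toFun := fun x => (show (K ≃ₐ[F] K) →₀ K from x) σ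
      map_zero' := rfl
      map_add' := fun _ _ => rfl }
  have hf : ∀ τ c, f (monomial Φ τ c) = if τ = σ then c else 0 := fun _ _ =>
    Finsupp.single_apply
  { f with
    map_smul' := fun a x => by
      change f (a • x) = a • f x
      induction x using CrossedProduct.induction with
      | h0 => simp
      | hadd x y hx hy => rw [smul_add, map_add, map_add, hx, hy, smul_add]
      | hm τ c =>
        rw [smul_monomial, hf, hf]
        split_ifs <;> simp }

open Classical in
theorem coeff_monomial (σ τ : K ≃ₐ[F] K) (c : K) :
    coeff Φ σ (monomial Φ τ c) = if τ = σ then c else 0 :=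
  Finsupp.single_apply

@[simp] theorem coeff_monomial_self (σ : K ≃ₐ[F] K) (c : K) :
    coeff Φ σ (monomial Φ σ c) = c := by
  simp [coeff_monomial]

theorem coeff_monomial_of_ne {σ τ : K ≃ₐ[F] K} (h : τ ≠ σ) (c : K) :
    coeff Φ σ (monomial Φ τ c) = 0 := by
  simp [coeff_monomial, h]

theorem ext_coeff {x y : CrossedProduct Φ} (h : ∀ σ, coeff Φ σ x = coeff Φ σ y) : x = y :=
  Finsupp.ext h

/-- The map `c ↦ e_σ c`, as an `F`-linear map. -/
noncomputable def monomialₗ (Φ : NormalizedCocycle F K) (σ : K ≃ₐ[F] K) :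
    K →ₗ[F] CrossedProduct Φ where
  toFun := monomial Φ σ
  map_add' := monomial_add σ
  map_smul' a c := (smul_monomial a σ c).symm

theorem coeff_mul_incl (σ : K ≃ₐ[F] K) (x : CrossedProduct Φ) (k : K) :
    coeff Φ σ (x * incl Φ k) = coeff Φ σ x * k := by
  induction x using CrossedProduct.induction with
  | h0 => simp
  | hadd x y hx hy => rw [add_mul, map_add, map_add, hx, hy, add_mul]
  | hm τ c =>
    change coeff Φ σ (_ * monomial Φ _ _) = _
    rw [monomial_mul_monomial, Φ.one_right, one_mul]
    change coeff Φ σ (monomial Φ τ (c * k)) = _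
    classical
    rw [coeff_monomial, coeff_monomial]
    split_ifs <;> simp

theorem coeff_incl_mul (σ : K ≃ₐ[F] K) (x : CrossedProduct Φ) (k : K) :
    coeff Φ σ (incl Φ k * x) = σ k * coeff Φ σ x := by
  induction x using CrossedProduct.induction with
  | h0 => simp
  | hadd x y hx hy => rw [mul_add, map_add, map_add, hx, hy, mul_add]
  | hm τ c =>
    change coeff Φ σ (monomial Φ _ _ * _) = _
    rw [monomial_mul_monomial, Φ.one_left, one_mul]
    change coeff Φ σ (monomial Φ τ (τ k * c)) = _
    classical
    rw [coeff_monomial, coeff_monomial]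
    split_ifs with h
    · rw [h]
    · simp

theorem coeff_mul_e (σ τ : K ≃ₐ[F] K) (x : CrossedProduct Φ) :
    coeff Φ (σ.trans τ) (x * e Φ τ) = Φ.toFun σ τ * τ (coeff Φ σ x) := by
  induction x using CrossedProduct.induction with
  | h0 => simp
  | hadd x y hx hy => simp only [add_mul, map_add, hx, hy, mul_add]
  | hm ρ c =>
    rw [e, monomial_mul_monomial, mul_one]
    by_cases h : ρ = σ
    · subst h
      simp
    · rw [coeff_monomial_of_ne h, coeff_monomial_of_ne, map_zero, mul_zero]
      intro h'
      exact h (AlgEquiv.ext fun k => τ.injective (DFunLike.congr_fun h' k))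

theorem coeff_incl (k : K) : coeff Φ AlgEquiv.refl (incl Φ k) = k :=
  coeff_monomial_self _ _

theorem sum_monomial_coeff [FiniteDimensional F K] (x : CrossedProduct Φ) :
    ∑ σ, monomial Φ σ (coeff Φ σ x) = x := by
  refine ext_coeff fun τ => ?_
  classical
  simp [map_sum, coeff_monomial]

/-- An element commuting with `K` belongs to `K`. -/
theorem mem_range_incl_of_commute {x : CrossedProduct Φ} (h : ∀ k, incl Φ k * x = x * incl Φ k) :
    x ∈ Set.range (incl Φ) := by
  refine ⟨coeff Φ AlgEquiv.refl x, ext_coeff fun σ => ?_⟩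
  by_cases hσ : AlgEquiv.refl = σ
  · subst hσ
    exact coeff_incl _
  · refine (coeff_monomial_of_ne hσ _).trans ?_
    -- A nonzero coefficient at `σ` can be cancelled from `σ k * c = c * k`, which makes `σ` the
    -- identity.
    by_contra hne
    refine hσ (AlgEquiv.ext fun k => ?_)
    have hk := congrArg (coeff Φ σ) (h k)
    rw [coeff_incl_mul, coeff_mul_incl, mul_comm] at hk
    exact (mul_left_cancel₀ (Ne.symm hne) hk).symm

theorem exists_e_mul_monomial_eq_one (σ : K ≃ₐ[F] K) :
    ∃ c, e Φ σ * monomial Φ σ.symm c = 1 := by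
  refine ⟨(Φ.toFun σ σ.symm)⁻¹, ?_⟩
  rw [e, monomial_mul_monomial, map_one, mul_one, mul_inv_cancel₀ (Φ.ne_zero _ _),
    AlgEquiv.self_trans_symm]
  rfl

theorem e_ne_zero (σ : K ≃ₐ[F] K) : e Φ σ ≠ 0 := fun h =>
  one_ne_zero (monomial_injective σ (h.trans (monomial_zero σ).symm))

end Coefficients

end CrossedProduct

/-! ### The faithful action of `D ⊗ K` on `D`, and the form that makes `*` its adjoint. -/

namespace CrossedProduct

section Action

variable {F K : Type*} [Field F] [Field K] [Algebra F K] {Φ : NormalizedCocycle F K}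

/-- The action of `D ⊗ K` on `D = (K / F, Φ)`, where `d ⊗ k` acts by `x ↦ d * x * k`. -/
noncomputable def action (Φ : NormalizedCocycle F K) :
    CrossedProduct Φ ⊗[F] K →ₐ[F] Module.End F (CrossedProduct Φ) :=
  Algebra.TensorProduct.lift (Algebra.lmul F (CrossedProduct Φ))
    (AlgHom.ofLinearMap
      ((LinearMap.mul F (CrossedProduct Φ)).flip ∘ₗ (incl Φ).toLinearMap)
      (LinearMap.ext fun x => by simp)
      (fun k l => LinearMap.ext fun x => by
        simp [mul_comm k l, mul_assoc]))
    (fun x k => LinearMap.ext fun y => by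
      simp [mul_assoc])

theorem action_tmul (d x : CrossedProduct Φ) (k : K) :
    action Φ (d ⊗ₜ k) x = d * x * incl Φ k := by
  refine (DFunLike.congr_fun (Algebra.TensorProduct.lift_tmul _ _ _ d k) x).trans ?_
  exact (mul_assoc _ _ _).symm

/-- Since `Φ` has no zeros, the action on the basis determines every component of every coefficient
of `t` in `K ⊗ K`; this gives faithfulness. -/
theorem coeff_action_e (t : CrossedProduct Φ ⊗[F] K) (σ τ : K ≃ₐ[F] K) :
    coeff Φ (σ.trans τ) (action Φ t (e Φ τ)) =
      Φ.toFun σ τ * galoisTensorHom F K ((coeff Φ σ).rTensor K t) τ := by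
  induction t with
  | zero => simp
  | add x y hx hy => simp only [map_add, LinearMap.add_apply, Pi.add_apply, mul_add, hx, hy]
  | tmul d k =>
    rw [action_tmul, coeff_mul_incl, coeff_mul_e, LinearMap.rTensor_tmul,
      galoisTensorHom_tmul, mul_assoc]

theorem action_injective [FiniteDimensional F K] [IsGalois F K] :
    Function.Injective (action Φ) := by
  refine (injective_iff_map_eq_zero _).2 fun t ht => ?_
  have hc : ∀ σ, (coeff Φ σ).rTensor K t = 0 := fun σ =>
    galoisTensorHom_injective <| by
      ext τ
      have h := coeff_action_e t σ τ
      rw [ht, LinearMap.zero_apply, map_zero] at h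
      rw [map_zero]
      exact (mul_eq_zero.1 h.symm).resolve_left (Φ.ne_zero σ τ)
  have hsum : ∀ t : CrossedProduct Φ ⊗[F] K,
      ∑ σ, (monomialₗ Φ σ).rTensor K ((coeff Φ σ).rTensor K t) = t := fun t => by
    induction t with
    | zero => simp
    | add x y hx hy => simp only [map_add, Finset.sum_add_distrib, hx, hy]
    | tmul d k =>
      simp only [LinearMap.rTensor_tmul, ← TensorProduct.sum_tmul]
      exact congrArg (· ⊗ₜ k) (sum_monomial_coeff d)
  rw [← hsum t]
  simp [hc]

end Action

section Involution

variable {F K : Type*} [Field F] [Field K] [Algebra F K] {Φ : NormalizedCocycle F K}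
  [StarRing (CrossedProduct Φ)]

theorem starK_starK (h : StarInvariant Φ) (k : K) : starK h (starK h k) = k :=
  (starRingK h).star_involutive k

theorem starK_one (h : StarInvariant Φ) : starK h 1 = 1 :=
  letI := starRingK h
  star_one K

theorem starK_zero (h : StarInvariant Φ) : starK h 0 = 0 :=
  letI := starRingK h
  star_zero K

theorem starK_injective (h : StarInvariant Φ) : Function.Injective (starK h) :=
  Function.LeftInverse.injective (starK_starK h)

/-- The form `⟨x, y⟩ = coeff_id (x^* y)` on the crossed product. -/
noncomputable def form (x y : CrossedProduct Φ) : K := coeff Φ AlgEquiv.refl (star x * y)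

theorem form_monomial_self (h : StarInvariant Φ) {a : K} {σ : K ≃ₐ[F] K}
    (ha : incl Φ a = star (e Φ σ) * e Φ σ) (c : K) :
    form (monomial Φ σ c) (monomial Φ σ c) = starK h c * a * c := by
  rw [form, ← e_mul_incl, star_mul, ← incl_starK h, mul_assoc, ← mul_assoc (star (e Φ σ)),
    ← ha, ← map_mul, ← map_mul, coeff_incl, mul_assoc]

/-- Once `e_σ^* e_σ` lies in `K`, the element `e_σ^*` is a monomial at `σ⁻¹`, so `e_σ^* e_τ` is
supported at `σ⁻¹τ ≠ id`. -/
theorem form_monomial_of_ne (h : StarInvariant Φ) {a : K} {σ τ : K ≃ₐ[F] K}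
    (ha : incl Φ a = star (e Φ σ) * e Φ σ) (hστ : σ ≠ τ) (c d : K) :
    form (monomial Φ σ c) (monomial Φ τ d) = 0 := by
  obtain ⟨b, hb⟩ := exists_e_mul_monomial_eq_one (Φ := Φ) σ
  have hstar : star (e Φ σ) = incl Φ a * monomial Φ σ.symm b := by
    rw [ha, mul_assoc, hb, mul_one]
  rw [form, ← e_mul_incl c, ← e_mul_incl d, star_mul, ← incl_starK h, hstar]
  simp only [mul_assoc]
  rw [← mul_assoc (monomial Φ σ.symm b), coeff_incl_mul, coeff_incl_mul,
    e, monomial_mul_monomial, coeff_mul_incl, coeff_monomial_of_ne, zero_mul, mul_zero, mul_zero]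
  intro hr
  refine hστ (AlgEquiv.ext fun k => ?_)
  simpa using (DFunLike.congr_fun hr (σ k)).symm

theorem form_self [FiniteDimensional F K] (h : StarInvariant Φ) {a : (K ≃ₐ[F] K) → K}
    (ha : ∀ σ, incl Φ (a σ) = star (e Φ σ) * e Φ σ) (x : CrossedProduct Φ) :
    form x x = ∑ σ, starK h (coeff Φ σ x) * a σ * coeff Φ σ x := by
  have hsum : form x x = ∑ σ, ∑ τ, form (monomial Φ τ (coeff Φ τ x))
      (monomial Φ σ (coeff Φ σ x)) := by
    conv_lhs => rw [← sum_monomial_coeff x]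
    simp only [form, star_sum, Finset.sum_mul, Finset.mul_sum, map_sum]
  rw [hsum]
  refine Finset.sum_congr rfl fun σ _ => ?_
  rw [Finset.sum_eq_single σ (fun τ _ hτ => form_monomial_of_ne h (ha τ) hτ _ _) (by simp),
    form_monomial_self h (ha σ)]

section Tensor

variable [FiniteDimensional F K] [IsGalois F K] (h : StarInvariant Φ)

theorem starTensor_zero : starTensor h 0 = 0 :=
  letI := starRingTensor h
  star_zero _

theorem starTensor_add (x y : CrossedProduct Φ ⊗[F] K) :
    starTensor h (x + y) = starTensor h x + starTensor h y :=
  (starRingTensor h).star_add x y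

/-- On the factor `K`, right multiplication of `x^* y` by `k` is traded for left multiplication;
both scale the coefficient at `e_id` by `k`, because `id` does not twist `k`. -/
theorem form_action (t : CrossedProduct Φ ⊗[F] K) (x y : CrossedProduct Φ) :
    form x (action Φ t y) = form (action Φ (starTensor h t) x) y := by
  induction t with
  | zero => simp [form, starTensor_zero]
  | add s t hs ht =>
    simp only [form, starTensor_add, map_add, LinearMap.add_apply, mul_add, star_add,
      add_mul] at hs ht ⊢
    rw [hs, ht]
  | tmul d k =>
    rw [starTensor_tmul, action_tmul, action_tmul]
    simp only [form, star_mul, star_star, ← incl_starK h, starK_starK]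
    rw [← mul_assoc, coeff_mul_incl, mul_assoc (incl Φ k), coeff_incl_mul, mul_comm, mul_assoc]
    rfl

end Tensor

end Involution

end CrossedProduct

/-! ### Consequences of pointedness and of formal reality. -/

theorem IsUnitalHermitianCone.zero_mem {R : Type*} [Ring R] {inv : R → R} {M : Set R}
    (h : IsUnitalHermitianCone inv M) : (0 : R) ∈ M :=
  (h.inter_neg.ge rfl : (0 : R) ∈ M ∩ {a | -a ∈ M}).1

theorem IsUnitalHermitianCone.sum_mem {R : Type*} [Ring R] {inv : R → R} {M : Set R}
    (h : IsUnitalHermitianCone inv M) {ι : Type*} {s : Finset ι} {f : ι → R}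
    (hf : ∀ i ∈ s, f i ∈ M) : ∑ i ∈ s, f i ∈ M :=
  Finset.sum_induction f (· ∈ M) (fun a b ha hb => h.add_mem a ha b hb) h.zero_mem hf

theorem IsUnitalHermitianCone.eq_zero_of_sum_eq_zero {R : Type*} [Ring R] {inv : R → R}
    {M : Set R} (h : IsUnitalHermitianCone inv M) {ι : Type*} {s : Finset ι} {f : ι → R}
    (hf : ∀ i ∈ s, f i ∈ M) (hs : ∑ i ∈ s, f i = 0) {i : ι} (hi : i ∈ s) : f i = 0 := by
  classical
  rw [← Finset.add_sum_erase s f hi] at hs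
  refine (h.inter_neg.le ⟨hf i hi, ?_⟩ : f i ∈ ({0} : Set R))
  rw [Set.mem_ofPred_eq, neg_eq_of_add_eq_zero_right hs]
  exact h.sum_mem fun j hj => hf j (Finset.mem_of_mem_erase hj)

theorem IsFormallyRealInvolution.mul_inv_eq_zero {R : Type*} [Ring R] {inv : R → R}
    (h : IsFormallyRealInvolution inv) {r s : R} (hrs : r * inv r + s * inv s = 0) :
    r * inv r = 0 :=
  h.eq_zero_of_add_eq_zero (AddSubmonoid.subset_closure ⟨r, rfl⟩)
    (AddSubmonoid.subset_closure ⟨s, rfl⟩) hrs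

/-- An idempotent `u` with `u * u^* = u^* * u = 0` vanishes, if the involution is formally
real. -/
theorem IsFormallyRealInvolution.eq_zero_of_mul_star_eq_zero {R : Type*} [Ring R]
    [StarRing R] (hreal : IsFormallyRealInvolution (star : R → R)) {u : R}
    (hu : u * u = u) (h1 : u * star u = 0) (h2 : star u * u = 0) : u = 0 := by
  have hu' : star u * star u = star u := by rw [← star_mul, hu]
  -- The orthogonal idempotents `u` and `u^*` make the elements `r r^*` for `r = u + u^*` and `r = u
  -- - u^*` opposite to each other, so both vanish.
  have hp : (u + star u) * star (u + star u) = u + star u := by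
    simp only [star_add, star_star, mul_add, add_mul, hu, hu', h1, h2]
    abel
  have hm : (u - star u) * star (u - star u) = -(u + star u) := by
    simp only [star_sub, star_star, mul_sub, sub_mul, hu, hu', h1, h2]
    abel
  have h0 := hreal.mul_inv_eq_zero (r := u + star u) (s := u - star u)
    (by rw [hp, hm, add_neg_cancel])
  rw [hp] at h0
  have := congrArg (u * ·) h0
  simpa [mul_add, hu, h1] using this

/-! ### The three implications. -/

namespace CrossedProduct

variable {F K : Type*} [Field F] [Field K] [Algebra F K] {Φ : NormalizedCocycle F K}
  [StarRing (CrossedProduct Φ)]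

/-- Makes the form definite rather than semidefinite; the division property enters only here. -/
theorem star_e_mul_e_ne_zero (hD : ∀ x : CrossedProduct Φ, x ≠ 0 → IsUnit x) (σ : K ≃ₐ[F] K) :
    star (e Φ σ) * e Φ σ ≠ 0 := fun h0 => by
  rw [(hD _ (e_ne_zero σ)).mul_left_eq_zero, star_eq_zero] at h0
  exact e_ne_zero σ h0

theorem isFormallyReal_starTensor [FiniteDimensional F K] [IsGalois F K] (h : StarInvariant Φ)
    {N : Set K} (hN : IsUnitalHermitianCone (starK h) N) {a : (K ≃ₐ[F] K) → K}
    (ha : ∀ σ, incl Φ (a σ) = star (e Φ σ) * e Φ σ) (haN : ∀ σ, a σ ∈ N)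
    (ha0 : ∀ σ, a σ ≠ 0) : IsFormallyRealInvolution (starTensor h) := by
  have hterm : ∀ x σ, starK h (coeff Φ σ x) * a σ * coeff Φ σ x ∈ N := fun x σ => by
    have := hN.conj_mem (starK h (coeff Φ σ x)) _ (haN σ)
    rwa [starK_starK] at this
  have hpos : ∀ x : CrossedProduct Φ, form x x ∈ N := fun x => by
    rw [form_self h ha]
    exact hN.sum_mem fun σ _ => hterm x σ
  have hdef : ∀ x : CrossedProduct Φ, form x x = 0 → x = 0 := fun x hx => by
    rw [form_self h ha] at hx
    refine ext_coeff fun σ => ?_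
    rw [map_zero]
    have hσ := hN.eq_zero_of_sum_eq_zero (fun σ _ => hterm x σ) hx (Finset.mem_univ σ)
    rcases mul_eq_zero.1 hσ with h1 | h1
    · rw [mul_eq_zero, or_iff_left (ha0 σ), ← starK_zero h] at h1
      exact starK_injective h h1
    · exact h1
  have hadj : ∀ (t : CrossedProduct Φ ⊗[F] K) x, form x (action Φ (t * starTensor h t) x) =
      form (action Φ (starTensor h t) x) (action Φ (starTensor h t) x) := fun t x => by
    rw [map_mul, Module.End.mul_apply, form_action h]
  intro n r hr hsum
  -- By faithfulness it suffices that the first term acts as zero, against its being nonzero.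
  refine hr 0 (action_injective (LinearMap.ext fun x => ?_))
  have h0 : ∑ i, form x (action Φ (r i * starTensor h (r i)) x) = 0 := by
    have : form x (action Φ (∑ i, r i * starTensor h (r i)) x) = 0 := by
      rw [hsum]
      simp [form]
    rw [← this]
    simp only [form, map_sum, LinearMap.sum_apply, Finset.mul_sum]
  simp only [hadj] at h0
  have hx := hdef _ (hN.eq_zero_of_sum_eq_zero (fun i _ => hpos _) h0 (Finset.mem_univ 0))
  rw [map_mul, Module.End.mul_apply, hx, map_zero, map_zero, LinearMap.zero_apply]

/-- Moving `k` past `e_σ` twists it by `σ`; as `*` commutes with `σ`, moving it past `e_σ^*` twists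
it by `σ⁻¹`. The twists cancel, and `K` is its own centralizer. -/
theorem star_e_mul_e_mem_range_incl (h : StarInvariant Φ)
    (hcomm : ∀ (k : K) (σ : K ≃ₐ[F] K), σ (starK h k) = starK h (σ k)) (σ : K ≃ₐ[F] K) :
    star (e Φ σ) * e Φ σ ∈ Set.range (incl Φ) := by
  refine mem_range_incl_of_commute fun k => ?_
  have hstar : star (e Φ σ) * incl Φ (σ.symm k) = incl Φ k * star (e Φ σ) := by
    have := congrArg star (incl_mul_e (Φ := Φ) (starK h (σ.symm k)) σ)
    rwa [star_mul, star_mul, hcomm, ← incl_starK h, ← incl_starK h, starK_starK, starK_starK,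
      AlgEquiv.apply_symm_apply] at this
  rw [← mul_assoc, ← hstar, mul_assoc, incl_mul_e, AlgEquiv.apply_symm_apply, mul_assoc]

/-- If the involution on the crossed product is formally real, then the sums of elements `d * d^*`
which belong to `K` form a unital hermitian cone on `K`. -/
theorem isUnitalHermitianCone_closure (h : StarInvariant Φ)
    (hreal : IsFormallyRealInvolution (star : CrossedProduct Φ → CrossedProduct Φ)) :
    IsUnitalHermitianCone (starK h) {k | incl Φ k ∈
      AddSubmonoid.closure (Set.range fun d : CrossedProduct Φ => d * star d)} where
  hermitian a ha := by
    refine incl_injective (Φ := Φ) ?_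
    rw [incl_starK]
    change incl Φ a ∈ AddSubmonoid.closure _ at ha
    -- The summands `d d^*` need not lie in `K`, so the induction runs in `D`.
    generalize incl Φ a = z at ha ⊢
    induction ha using AddSubmonoid.closure_induction with
    | mem x hx =>
      obtain ⟨d, rfl⟩ := hx
      simp
    | zero => simp
    | add x y _ _ hx hy => rw [star_add, hx, hy]
  add_mem a ha b hb := by
    rw [Set.mem_ofPred_eq, map_add]
    exact add_mem ha hb
  conj_mem a b hb := by
    rw [Set.mem_ofPred_eq, map_mul, map_mul, incl_starK]
    change incl Φ b ∈ AddSubmonoid.closure _ at hb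
    generalize incl Φ b = z at hb ⊢
    induction hb using AddSubmonoid.closure_induction with
    | mem x hx =>
      obtain ⟨d, rfl⟩ := hx
      refine AddSubmonoid.subset_closure ⟨incl Φ a * d, ?_⟩
      simp only [star_mul, mul_assoc]
    | zero => simp
    | add x y _ _ hx hy =>
      rw [mul_add, add_mul]
      exact add_mem hx hy
  -- The only cone axiom that needs formal reality.
  inter_neg := by
    refine Set.Subset.antisymm (fun a ha => ?_) ?_
    · refine incl_injective (Φ := Φ) ((hreal.eq_zero_of_add_eq_zero ha.1 ha.2 ?_).trans
        (map_zero _).symm)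
      rw [← map_add, add_neg_cancel, map_zero]
    · rintro _ rfl
      simp
  one_mem := AddSubmonoid.subset_closure ⟨1, by simp⟩

section Tensor

variable [FiniteDimensional F K] [IsGalois F K] (h : StarInvariant Φ)

theorem isFormallyReal_of_starTensor (hreal : IsFormallyRealInvolution (starTensor h)) :
    IsFormallyRealInvolution (star : CrossedProduct Φ → CrossedProduct Φ) := by
  have hinj : Function.Injective
      (Algebra.TensorProduct.includeLeft : CrossedProduct Φ →ₐ[F] CrossedProduct Φ ⊗[F] K) :=
    Algebra.TensorProduct.includeLeft_injective (algebraMap F K).injective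
  have hterm : ∀ d : CrossedProduct Φ, (d ⊗ₜ[F] (1 : K)) * starTensor h (d ⊗ₜ[F] (1 : K)) =
      (Algebra.TensorProduct.includeLeft : CrossedProduct Φ →ₐ[F] CrossedProduct Φ ⊗[F] K)
        (d * star d) := fun d => by
    rw [starTensor_tmul, starK_one, Algebra.TensorProduct.tmul_mul_tmul, one_mul]
    rfl
  intro n r hr hsum
  refine hreal n (fun i => r i ⊗ₜ 1) (fun i => ?_) ?_
  · rw [hterm]
    exact (map_ne_zero_iff _ hinj).2 (hr i)
  · simp only [hterm]
    rw [← map_sum, hsum, map_zero]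

theorem starK_comm_of_starTensor (hreal : IsFormallyRealInvolution (starTensor h)) (k : K)
    (σ : K ≃ₐ[F] K) : σ (starK h k) = starK h (σ k) := by
  classical
  let j : K ⊗[F] K →ₐ[F] CrossedProduct Φ ⊗[F] K :=
    Algebra.TensorProduct.map (incl Φ) (AlgHom.id F K)
  have hj : Function.Injective j :=
    Module.Flat.rTensor_preserves_injective_linearMap (M := K) (incl Φ).toLinearMap
      incl_injective
  let _ := starRingF h
  let _ := starRingK h
  have := starModuleK h
  have hstar : ∀ x, j (star x) = starTensor h (j x) := fun x => by
    induction x with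
    | zero => simp [starTensor_zero]
    | add x y hx hy => rw [star_add, map_add, map_add, starTensor_add, hx, hy]
    | tmul k l =>
      rw [TensorProduct.star_tmul]
      change incl Φ (starK h k) ⊗ₜ[F] starK h l = starTensor h (incl Φ k ⊗ₜ[F] l)
      rw [starTensor_tmul, incl_starK]
  -- The primitive idempotent of `K ⊗ K` belonging to `σ`.
  obtain ⟨ε, hε⟩ := galoisTensorHom_surjective (F := F) (K := K) (Pi.single σ 1)
  have hεm : ∀ x : K ⊗[F] K, galoisTensorHom F K (ε * x) =
      Pi.single σ (galoisTensorHom F K x σ) := fun x => by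
    rw [map_mul, hε]
    ext τ
    by_cases hτ : τ = σ
    · subst hτ; simp
    · simp [hτ]
  have hεε : ε * ε = ε := galoisTensorHom_injective (by rw [hεm, hε]; simp)
  have hstarε : star ε * star ε = star ε := by rw [← star_mul, hεε]
  -- The `σ`-component of `ε^*` is an idempotent of a field. The value `0` would give `ε ε^* = 0`,
  -- contrary to formal reality, so it is `1`.
  have hsq : galoisTensorHom F K (star ε) σ * galoisTensorHom F K (star ε) σ =
      galoisTensorHom F K (star ε) σ := by
    rw [← Pi.mul_apply, ← map_mul, hstarε]
  have hne : galoisTensorHom F K (star ε) σ ≠ 0 := fun h0 => by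
    have hzero : ε * star ε = 0 := galoisTensorHom_injective (by
      rw [hεm, h0, map_zero, Pi.single_zero])
    let _ := starRingTensor h
    have hj0 : j ε = 0 := by
      refine IsFormallyRealInvolution.eq_zero_of_mul_star_eq_zero hreal ?_ ?_ ?_
      · rw [← map_mul, hεε]
      · exact (congrArg (j ε * ·) (hstar ε)).symm.trans
          ((map_mul j _ _).symm.trans ((congrArg j hzero).trans (map_zero j)))
      · exact (congrArg (· * j ε) (hstar ε)).symm.trans
          ((map_mul j _ _).symm.trans
            ((congrArg j ((mul_comm _ _).trans hzero)).trans (map_zero j)))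
    have : ε = 0 := hj (hj0.trans (map_zero j).symm)
    rw [this, map_zero] at hε
    simpa using congrFun hε σ
  have hone : galoisTensorHom F K (star ε) σ = 1 :=
    mul_left_cancel₀ hne (by rw [hsq, mul_one])
  have hmul : ε * star ε = ε := galoisTensorHom_injective (by rw [hεm, hone, hε])
  have hself : star ε = ε := by
    conv_rhs => rw [← hmul]
    conv_lhs => rw [← hmul]
    rw [star_mul, star_star]
  -- This relation expresses `σ` through `ε`; since `ε` is hermitian, its star has `σ`-component `σ
  -- (k^*) - (σ k)^*`.
  have hk : ε * (k ⊗ₜ[F] (1 : K) - 1 ⊗ₜ[F] σ k) = 0 := galoisTensorHom_injective (by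
    rw [hεm]; simp)
  have hk' := congrArg (fun x => galoisTensorHom F K (star x) σ) hk
  simp only [star_mul, star_sub, hself, TensorProduct.star_tmul, star_one, star_zero, map_zero,
    Pi.zero_apply] at hk'
  rw [mul_comm, hεm] at hk'
  simp only [Pi.single_eq_same, map_sub, Pi.sub_apply, galoisTensorHom_tmul, map_one, one_mul,
    mul_one] at hk'
  exact sub_eq_zero.1 hk'

end Tensor

end CrossedProduct

theorem mainTheorem4 {F K : Type*} [Field F] [Field K] [Algebra F K]
    [FiniteDimensional F K] [IsGalois F K] (Φ : NormalizedCocycle F K)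
    (hD : ∀ x : CrossedProduct Φ, x ≠ 0 → IsUnit x)
    [StarRing (CrossedProduct Φ)] (hK : CrossedProduct.StarInvariant Φ) :
    List.TFAE
      [IsFormallyRealInvolution (CrossedProduct.starTensor hK),
       IsFormallyRealInvolution (star : CrossedProduct Φ → CrossedProduct Φ) ∧
        ∀ (k : K) (σ : K ≃ₐ[F] K),
          σ (CrossedProduct.starK hK k) = CrossedProduct.starK hK (σ k),
       (∀ σ : K ≃ₐ[F] K,
          star (CrossedProduct.e Φ σ) * CrossedProduct.e Φ σ
            ∈ Set.range (CrossedProduct.incl Φ)) ∧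
        ∃ N : Set K, IsUnitalHermitianCone (CrossedProduct.starK hK) N ∧
          ∀ σ : K ≃ₐ[F] K,
            star (CrossedProduct.e Φ σ) * CrossedProduct.e Φ σ
              ∈ CrossedProduct.incl Φ '' N] := by
  tfae_have 1 → 2 := fun h =>
    ⟨CrossedProduct.isFormallyReal_of_starTensor hK h,
      CrossedProduct.starK_comm_of_starTensor hK h⟩
  tfae_have 2 → 3 := fun ⟨hreal, hcomm⟩ => by
    have hmem := CrossedProduct.star_e_mul_e_mem_range_incl hK hcomm
    refine ⟨hmem, _, CrossedProduct.isUnitalHermitianCone_closure hK hreal, fun σ => ?_⟩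
    obtain ⟨a, ha⟩ := hmem σ
    refine ⟨a, ?_, ha⟩
    rw [Set.mem_ofPred_eq, ha]
    exact AddSubmonoid.subset_closure
      ⟨star (CrossedProduct.e Φ σ), by simp only [star_star]⟩
  tfae_have 3 → 1 := fun ⟨_, N, hN, hmem⟩ => by
    choose a haN ha using hmem
    refine CrossedProduct.isFormallyReal_starTensor hK hN ha haN fun σ h0 => ?_
    refine CrossedProduct.star_e_mul_e_ne_zero hD σ ?_
    rw [← ha, h0, map_zero]
  tfae_finish
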